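/- Let $G_{n,p}$ denote the binomial random graph on the vertex set $[n]=\{1,\dots,n\}$, in which each pair of vertices is an edge independently with probability $p$. A vertex set $A$ dominates a vertex set $S$ if every vertex in $S\setminus A$ has at least one neighbor in $A$; a dominating set is a vertex set that dominates $[n]$, and $A$ and $B$ dominate each other if $A$ dominates $B$ and $B$ dominates $A$. Let $X_r$ be the number of dominating sets of size $r$ in $G_{n,p}$, and let $$\hat r=\hat r(n,p):=\min\{r : \mathbb{E}X_r\ge 1/(np)\}.$$ Let $p=p(n)$ satisfy $(\log n)^3 n^{-2/3}\le p\le 1$ for all sufficiently large $n$, and put $r=r(n):=\hat r(n,p)+1$. Then there is a sequence $\varepsilon_n\to 0$ (depending only on the function $p$) such that for all sufficiently large $n$, all integers $s$ and all vertex sets $A,B\in\binom{[n]}{r}$ with $|A\cap B|=s$, $$\mathbb{P}\bigl(A\text{ and }B\text{ dominate each other in }G_{n,p}\bigr)\le (1+\varepsilon_n)\,\bigl(1-2(1-p)^r\bigr)^{r-s}.$$ -/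

import Mathlib

open MeasureTheory Filter Topology

namespace RandomDomination

/-- In the graph `G`, the vertex set `A` dominates the vertex set `S`: every vertex of `S` outside
`A` has at least one neighbor in `A`. -/
def Dominates {V : Type*} (G : SimpleGraph V) (A S : Finset V) : Prop :=
  ∀ v ∈ S, v ∉ A → ∃ u ∈ A, G.Adj u v

/-- `A` and `B` dominate each other in `G`. -/
def DominateEachOther {V : Type*} (G : SimpleGraph V) (A B : Finset V) : Prop :=
  Dominates G A B ∧ Dominates G B A

/-- `K` is a dominating set of `G`: every vertex outside `K` has a neighbor in `K`. -/
def IsDominatingSet {V : Type*} [Fintype V] (G : SimpleGraph V) (K : Finset V) : Prop :=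
  Dominates G K Finset.univ

open Classical in
/-- The number `X_r` of dominating sets of size `r` of the graph `G`. -/
noncomputable def numDominatingSets {V : Type*} [Fintype V] (G : SimpleGraph V) (r : ℕ) : ℕ :=
  ((Finset.univ.powersetCard r).filter fun K => IsDominatingSet G K).card

/-- The expected number `𝔼 X_r` of dominating sets of size `r` of the binomial random graph
`G_{n,p}`. -/
noncomputable def expectedNumDominatingSets (n : ℕ) (p : unitInterval) (r : ℕ) : ℝ :=
  ∫ G, (numDominatingSets G r : ℝ) ∂(SimpleGraph.binomialRandom (Fin n) p)

/-- The expectation threshold `r̂(n, p) = min {r : 𝔼 X_r ≥ 1 / (n p)}`. As `X_n = 1` always, the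
set of such `r` contains `n`, and so is non-empty, whenever `n p ≥ 1`. -/
noncomputable def rHat (n : ℕ) (p : unitInterval) : ℕ :=
  sInf {r : ℕ | 1 / ((n : ℝ) * (p : ℝ)) ≤ expectedNumDominatingSets n p r}

end RandomDomination

/-! Write q = 1 - p, U = A \ B, W = B \ A, C = A ∩ B, k = r - s. Each vertex of W has a neighbour in
A independently, which costs (1 - q^r)^k. Under this conditioning the rows (the edges from one w ∈ W
to A) are independent product measures conditioned on being non-zero. Such a row misses a given u ∈
A with probability π = (q - q^r)/(1 - q^r), slightly below q, and increasing functions of its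
separate coordinates are negatively correlated. Hence the events that u ∈ U has a neighbour in B are
jointly no likelier than if independent. The edges from U to C are untouched, so the probability is
at most (1 - q^r)^k (1 - q^s π^k)^k: this is `subsetMean_cross_le` and
`binomialRandom_real_dominateEachOther_le`.

Since q^s π^k is nearly q^r, each pair of factors is nearly (1 - q^r)^2, hence nearly 1 - 2 q^r;
`mutual_bound_le` records the loss as an exponential. With R = r - 1 the expectation threshold, the
first moment forces R = O(log n / p) and q^R = O((log n)^2 / (np)). The exponent is then O((log n)^6
/ (n^2 p^3)), which tends to 0 exactly because p ≥ (log n)^3 n^(-2/3) (`correction_le`). -/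

namespace RandomDomination

/-! ### Product measure on subsets of a finite set, as finite sums. -/

section RandomSubset

variable {α ι : Type*} [DecidableEq α]

/-- The mean of `f` over the random subset of `F` that contains each element of `F` independently
with probability `p`. -/
noncomputable def subsetMean (p : ℝ) (F : Finset α) (f : Finset α → ℝ) : ℝ :=
  ∑ T ∈ F.powerset, p ^ T.card * (1 - p) ^ (F \ T).card * f T

variable {p : ℝ} {F F' : Finset α} {f g : Finset α → ℝ}

@[simp] lemma subsetMean_empty : subsetMean p ∅ f = f ∅ := by simp [subsetMean]

lemma subsetMean_congr (h : ∀ T ⊆ F, f T = g T) : subsetMean p F f = subsetMean p F g :=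
  Finset.sum_congr rfl fun T hT => by rw [h T (Finset.mem_powerset.1 hT)]

lemma subsetMean_mono (h0 : 0 ≤ p) (h1 : p ≤ 1) (h : ∀ T ⊆ F, f T ≤ g T) :
    subsetMean p F f ≤ subsetMean p F g := by
  have : 0 ≤ 1 - p := by linarith
  exact Finset.sum_le_sum fun T hT =>
    mul_le_mul_of_nonneg_left (h T (Finset.mem_powerset.1 hT)) (by positivity)

lemma subsetMean_const_mul (c : ℝ) :
    subsetMean p F (fun T => c * f T) = c * subsetMean p F f := by
  simp only [subsetMean, Finset.mul_sum]
  exact Finset.sum_congr rfl fun T _ => by ring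

lemma subsetMean_mul_const (c : ℝ) :
    subsetMean p F (fun T => f T * c) = subsetMean p F f * c := by
  simp only [mul_comm _ c, subsetMean_const_mul]

lemma subsetMean_sub :
    subsetMean p F (fun T => f T - g T) = subsetMean p F f - subsetMean p F g := by
  simp only [subsetMean, ← Finset.sum_sub_distrib, mul_sub]

lemma subsetMean_insert {e : α} (he : e ∉ F) :
    subsetMean p (insert e F) f =
      (1 - p) * subsetMean p F f + p * subsetMean p F (fun T => f (insert e T)) := by
  rw [subsetMean, Finset.sum_powerset_insert he]
  simp only [subsetMean, Finset.mul_sum]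
  congr 1
  · refine Finset.sum_congr rfl fun T hT => ?_
    have hT := Finset.mem_powerset.1 hT
    rw [Finset.insert_sdiff_of_notMem _ (fun h => he (hT h)),
      Finset.card_insert_of_notMem (by simp [he])]
    ring
  · refine Finset.sum_congr rfl fun T hT => ?_
    have hT := Finset.mem_powerset.1 hT
    rw [Finset.insert_sdiff_insert, Finset.card_insert_of_notMem (fun h => he (hT h)),
      Finset.sdiff_insert_of_notMem he]
    ring

lemma subsetMean_singleton (e : α) :
    subsetMean p {e} f = (1 - p) * f ∅ + p * f {e} := by
  rw [← insert_empty_eq, subsetMean_insert (by simp)]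
  simp

lemma subsetMean_const (c : ℝ) : subsetMean p F (fun _ => c) = c := by
  induction F using Finset.induction_on with
  | empty => simp
  | insert e F he ih => rw [subsetMean_insert he, ih]; ring

/-- Fubini: disjoint blocks of coordinates can be revealed one after the other. -/
lemma subsetMean_union (h : Disjoint F F') :
    subsetMean p (F ∪ F') f = subsetMean p F fun T => subsetMean p F' fun T' => f (T ∪ T') := by
  induction F using Finset.induction_on generalizing f with
  | empty => simp
  | insert e F he ih =>
    rw [Finset.disjoint_insert_left] at h
    rw [Finset.insert_union, subsetMean_insert (by simp [he, h.1]), subsetMean_insert he,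
      ih h.2, ih h.2]
    simp only [Finset.insert_union]

/-- Integrates out the coordinates on which an event does not depend. -/
lemma subsetMean_inter_of_subset (h : F ⊆ F') :
    subsetMean p F' (fun T => f (T ∩ F)) = subsetMean p F f := by
  rw [← Finset.union_sdiff_of_subset h, subsetMean_union Finset.disjoint_sdiff]
  refine subsetMean_congr fun T hT => ?_
  rw [← subsetMean_const (p := p) (F := F' \ F) (f T)]
  refine subsetMean_congr fun T' hT' => ?_
  congr 1
  grind

lemma subsetMean_ite_eq_empty :
    subsetMean p F (fun T => if T = ∅ then 1 else 0) = (1 - p) ^ F.card := by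
  simp [subsetMean]

/-- Independence over disjoint blocks. -/
lemma subsetMean_prod [DecidableEq ι] (I : Finset ι) (S : ι → Finset α)
    (h : (I : Set ι).PairwiseDisjoint S) (φ : ι → Finset α → ℝ) :
    subsetMean p (I.biUnion S) (fun T => ∏ i ∈ I, φ i (T ∩ S i)) =
      ∏ i ∈ I, subsetMean p (S i) (φ i) := by
  induction I using Finset.induction_on with
  | empty => simp
  | insert i I hi ih =>
    rw [Finset.coe_insert, Set.pairwiseDisjoint_insert_of_notMem (by simpa using hi)] at h
    have hd : Disjoint (S i) (I.biUnion S) := by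
      rw [Finset.disjoint_biUnion_right]
      exact fun j hj => h.2 j hj
    rw [Finset.biUnion_insert, subsetMean_union hd, Finset.prod_insert hi, ← ih h.1,
      ← subsetMean_mul_const]
    refine subsetMean_congr fun T hT => ?_
    rw [← subsetMean_const_mul]
    refine subsetMean_congr fun T' hT' => ?_
    rw [Finset.prod_insert hi]
    congr 1
    · congr 1
      ext x
      have : x ∈ S i → x ∉ I.biUnion S := fun h => Finset.disjoint_left.1 hd h
      grind
    · refine Finset.prod_congr rfl fun j hj => ?_
      congr 1
      ext x
      have : x ∈ S i → x ∉ S j := fun h' => Finset.disjoint_left.1 (h.2 j hj) h'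
      grind

end RandomSubset

/-! ### The algebraic form of negative correlation. -/

/-- For `t ∈ [0, 1]`, the inequality `E ∏ f_u ≤ ∏ E f_u` for increasing functions of the
coordinates of a product measure conditioned on not vanishing. -/
lemma prod_sub_mul_prod_mul_pow_le {ι : Type*} [DecidableEq ι] (I : Finset ι) {t : ℝ} (h0 : 0 ≤ t)
    (h1 : t ≤ 1) (M z : ι → ℝ) (hz : ∀ i ∈ I, 0 ≤ z i) (hM : ∀ i ∈ I, z i ≤ M i) :
    (∏ i ∈ I, M i - t * ∏ i ∈ I, z i) * (1 - t) ^ I.card ≤ (1 - t) * ∏ i ∈ I, (M i - t * z i) := by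
  induction I using Finset.induction_on with
  | empty => simp
  | insert i I hi ih =>
    simp only [Finset.mem_insert, forall_eq_or_imp] at hz hM
    have ih := ih hz.2 hM.2
    rw [Finset.prod_insert hi, Finset.prod_insert hi, Finset.prod_insert hi,
      Finset.card_insert_of_notMem hi]
    have hP : ∏ i ∈ I, z i ≤ ∏ i ∈ I, M i := Finset.prod_le_prod hz.2 hM.2
    have h2 : 0 ≤ M i - t * z i := by nlinarith [hz.1, hM.1]
    -- Right side minus left side is exactly t (M i - z i) (∏ M - ∏ z).
    have h3 : (M i * ∏ i ∈ I, M i - t * (z i * ∏ i ∈ I, z i)) * (1 - t) ≤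
        (M i - t * z i) * (∏ i ∈ I, M i - t * ∏ i ∈ I, z i) := by
      nlinarith [mul_nonneg h0 (mul_nonneg (sub_nonneg.2 hM.1) (sub_nonneg.2 hP))]
    have h4 : 0 ≤ (1 - t) ^ I.card := pow_nonneg (by linarith) _
    calc _ = (M i * ∏ i ∈ I, M i - t * (z i * ∏ i ∈ I, z i)) * (1 - t) * (1 - t) ^ I.card := by ring
      _ ≤ (M i - t * z i) * (∏ i ∈ I, M i - t * ∏ i ∈ I, z i) * (1 - t) ^ I.card :=
        mul_le_mul_of_nonneg_right h3 h4
      _ = (M i - t * z i) * ((∏ i ∈ I, M i - t * ∏ i ∈ I, z i) * (1 - t) ^ I.card) := by ring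
      _ ≤ (M i - t * z i) * ((1 - t) * ∏ i ∈ I, (M i - t * z i)) :=
        mul_le_mul_of_nonneg_left ih h2
      _ = _ := by ring

/-! ### Stars and negative correlation in the bipartite graph between W and A. -/

section Graph

variable {V : Type*} [DecidableEq V]

/-- The pairs `{v, u}` with `u ∈ A`. -/
def star (v : V) (A : Finset V) : Finset (Sym2 V) := A.image fun u => s(v, u)

/-- The pairs `{v, u}` with `v ∈ W` and `u ∈ A`. -/
def cross (W A : Finset V) : Finset (Sym2 V) := W.biUnion fun v => star v A

lemma mem_star {v : V} {A : Finset V} {e : Sym2 V} : e ∈ star v A ↔ ∃ u ∈ A, s(v, u) = e := by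
  simp [star]

lemma mk_mem_star {v u : V} {A : Finset V} (h : u ∈ A) : s(v, u) ∈ star v A :=
  mem_star.2 ⟨u, h, rfl⟩

lemma mk_mem_cross {v u : V} {W A : Finset V} (hv : v ∈ W) (hu : u ∈ A) : s(v, u) ∈ cross W A :=
  Finset.mem_biUnion.2 ⟨v, hv, mk_mem_star hu⟩

lemma mem_cross {W A : Finset V} {e : Sym2 V} : e ∈ cross W A ↔ ∃ v ∈ W, ∃ u ∈ A, s(v, u) = e := by
  simp [cross, mem_star]

lemma card_star (v : V) (A : Finset V) : (star v A).card = A.card :=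
  Finset.card_image_of_injective _ fun _ _ h => Sym2.congr_right.1 h

lemma disjoint_star {v w : V} {A : Finset V} (hvw : v ≠ w) (hv : v ∉ A) :
    Disjoint (star v A) (star w A) := by
  rw [Finset.disjoint_left]
  intro e h1 h2
  obtain ⟨u, hu, rfl⟩ := mem_star.1 h1
  obtain ⟨u', hu', h⟩ := mem_star.1 h2
  rw [Sym2.eq_iff] at h
  grind

lemma pairwiseDisjoint_star {W A : Finset V} (h : Disjoint W A) :
    (W : Set V).PairwiseDisjoint fun v => star v A :=
  fun _ hv _ _ hvw => disjoint_star hvw (Finset.disjoint_left.1 h hv)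

lemma star_eq_biUnion (v : V) (A : Finset V) :
    star v A = A.biUnion fun u => {s(v, u)} := by
  ext; simp [star, eq_comm]

lemma inter_star_eq_empty {v : V} {A : Finset V} {T : Finset (Sym2 V)} :
    T ∩ star v A = ∅ ↔ ∀ u ∈ A, s(v, u) ∉ T := by
  simp only [Finset.ext_iff, Finset.mem_inter, mem_star, Finset.notMem_empty, iff_false]
  grind

variable {p : ℝ}

/-- One row of the row-by-row bound: the neighbourhood of `w` in `A` is conditioned to be
non-empty. -/
lemma subsetMean_star_le (h0 : 0 < p) (h1 : p ≤ 1) (w : V) {A : Finset V} (hA : A.Nonempty)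
    (d : V → ℝ) (hd : ∀ u ∈ A, 0 ≤ d u ∧ d u ≤ 1) :
    subsetMean p (star w A) (fun T => (if T = ∅ then 0 else 1) *
        ∏ u ∈ A, (1 - d u * if s(w, u) ∈ T then 0 else 1)) ≤
      (1 - (1 - p) ^ A.card) *
        ∏ u ∈ A, (1 - d u * (((1 - p) - (1 - p) ^ A.card) / (1 - (1 - p) ^ A.card))) := by
  set t := (1 - p) ^ A.card with ht
  have ht0 : 0 ≤ t := pow_nonneg (by linarith) _
  have ht1 : t < 1 := pow_lt_one₀ (by linarith) (by linarith) hA.card_ne_zero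
  -- The unconditioned mean factorizes over the edges; the empty row, of probability t, is then
  -- subtracted.
  have e1 : subsetMean p (star w A) (fun T => (if T = ∅ then 0 else 1) *
        ∏ u ∈ A, (1 - d u * if s(w, u) ∈ T then 0 else 1)) =
      ∏ u ∈ A, (1 - d u * (1 - p)) - t * ∏ u ∈ A, (1 - d u) := by
    have h2 := subsetMean_prod (p := p) A (fun u => ({s(w, u)} : Finset (Sym2 V)))
      (fun a _ b _ hab => Finset.disjoint_singleton.2 fun h => hab (Sym2.congr_right.1 h))
      (fun u T => 1 - d u * if s(w, u) ∈ T then 0 else 1)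
    rw [← star_eq_biUnion] at h2
    simp only [subsetMean_singleton, Finset.mem_inter, Finset.mem_singleton, and_true] at h2
    have h3 := subsetMean_ite_eq_empty (p := p) (F := star w A)
    rw [card_star, ← ht] at h3
    rw [← h3, ← subsetMean_mul_const]
    have h4 : ∏ u ∈ A, (1 - d u * (1 - p)) = _ := (h2.trans (Finset.prod_congr rfl fun u _ => by
      simp; ring)).symm
    rw [h4, ← subsetMean_sub]
    refine subsetMean_congr fun T _ => ?_
    by_cases hT : T = ∅ <;> simp [hT]
  rw [e1]
  have key := prod_sub_mul_prod_mul_pow_le A ht0 ht1.le (fun u => 1 - d u * (1 - p))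
    (fun u => 1 - d u) (fun u hu => by linarith [hd u hu])
    (fun u hu => by nlinarith [hd u hu])
  -- This factorization brings out the conditional probability π of a missing edge.
  have h5 : ∀ u ∈ A, 1 - d u * (1 - p) - t * (1 - d u) =
      (1 - t) * (1 - d u * ((1 - p - t) / (1 - t))) := fun u _ => by
    field_simp [(sub_pos.2 ht1).ne']
    ring
  rw [Finset.prod_congr rfl h5, Finset.prod_mul_distrib, Finset.prod_const] at key
  have h6 : 0 < (1 - t) ^ A.card := pow_pos (by linarith) _
  refine le_of_mul_le_mul_right ?_ h6
  linarith

/-- Given that every vertex of `W` has a neighbour in `A`, the events that a vertex of `A` has a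
neighbour in `W` are negatively correlated. -/
lemma subsetMean_cross_le (h0 : 0 < p) (h1 : p ≤ 1) {W A : Finset V} (hA : A.Nonempty)
    (hWA : Disjoint W A) (c : V → ℝ) (hc : ∀ u ∈ A, 0 ≤ c u ∧ c u ≤ 1) :
    subsetMean p (cross W A) (fun T => (∏ w ∈ W, if T ∩ star w A = ∅ then 0 else 1) *
        ∏ u ∈ A, (1 - c u * if ∀ w ∈ W, s(w, u) ∉ T then 1 else 0)) ≤
      (1 - (1 - p) ^ A.card) ^ W.card *
        ∏ u ∈ A, (1 - c u *
          (((1 - p) - (1 - p) ^ A.card) / (1 - (1 - p) ^ A.card)) ^ W.card) := by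
  set t := (1 - p) ^ A.card with ht
  have ht0 : 0 ≤ t := pow_nonneg (by linarith) _
  have ht1 : t < 1 := pow_lt_one₀ (by linarith) (by linarith) hA.card_ne_zero
  have ht2 : t ≤ 1 - p := pow_le_of_le_one (by linarith) (by linarith) hA.card_ne_zero
  set π := (1 - p - t) / (1 - t) with hπ
  have hπ0 : 0 ≤ π := div_nonneg (by linarith) (by linarith)
  have hπ1 : π ≤ 1 := (div_le_one (by linarith)).2 (by linarith)
  -- The weights must vary: once row w is revealed, the other rows see the weight c u if w misses u,
  -- and 0 otherwise.
  induction W using Finset.induction_on generalizing c with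
  | empty => simp [cross]
  | insert w W hw ih =>
    rw [Finset.disjoint_insert_left] at hWA
    have hd : Disjoint (star w A) (cross W A) := by
      rw [cross, Finset.disjoint_biUnion_right]
      exact fun v hv => disjoint_star (by rintro rfl; exact hw hv) hWA.1
    have hcr : cross (insert w W) A = star w A ∪ cross W A := by simp [cross]
    rw [hcr, subsetMean_union hd, Finset.card_insert_of_notMem hw]
    have hstep : ∀ T ⊆ star w A, subsetMean p (cross W A) (fun T' =>
        (∏ v ∈ insert w W, if (T ∪ T') ∩ star v A = ∅ then 0 else 1) *
        ∏ u ∈ A, (1 - c u * if ∀ v ∈ insert w W, s(v, u) ∉ T ∪ T' then 1 else 0)) ≤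
        (1 - t) ^ W.card * ((if T = ∅ then 0 else 1) *
          ∏ u ∈ A, (1 - c u * π ^ W.card * if s(w, u) ∈ T then 0 else 1)) := by
      intro T hT
      have h2 : ∀ T' ⊆ cross W A,
          (∏ v ∈ insert w W, if (T ∪ T') ∩ star v A = ∅ then (0 : ℝ) else 1) *
            ∏ u ∈ A, (1 - c u * if ∀ v ∈ insert w W, s(v, u) ∉ T ∪ T' then 1 else 0) =
          (if T = ∅ then 0 else 1) * ((∏ v ∈ W, if T' ∩ star v A = ∅ then 0 else 1) *
            ∏ u ∈ A, (1 - (c u * if s(w, u) ∈ T then 0 else 1) *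
              if ∀ v ∈ W, s(v, u) ∉ T' then 1 else 0)) := by
        intro T' hT'
        have a1 : (T ∪ T') ∩ star w A = T := by
          ext e
          have : e ∈ star w A → e ∉ cross W A := fun h => Finset.disjoint_left.1 hd h
          grind
        have a2 : ∀ v ∈ W, (T ∪ T') ∩ star v A = T' ∩ star v A := by
          intro v hv
          ext e
          have h3 : e ∈ star v A → e ∈ cross W A := fun h => Finset.mem_biUnion.2 ⟨v, hv, h⟩
          have : e ∈ star w A → e ∉ cross W A := fun h => Finset.disjoint_left.1 hd h
          grind
        have a3 : ∀ u ∈ A, (∀ v ∈ insert w W, s(v, u) ∉ T ∪ T') ↔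
            (s(w, u) ∉ T ∧ ∀ v ∈ W, s(v, u) ∉ T') := by
          intro u hu
          have b1 : s(w, u) ∉ T' := fun h =>
            Finset.disjoint_left.1 hd (mk_mem_star hu) (hT' h)
          have b2 : ∀ v ∈ W, s(v, u) ∉ T := fun v hv h =>
            Finset.disjoint_left.1 hd (hT h) (mk_mem_cross hv hu)
          grind
        rw [Finset.prod_insert hw, a1, mul_assoc]
        congr 2
        · exact Finset.prod_congr rfl fun v hv => by rw [a2 v hv]
        · refine Finset.prod_congr rfl fun u hu => ?_
          simp only [a3 u hu]
          by_cases h : s(w, u) ∈ T <;> simp [h]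
      rw [subsetMean_congr h2, subsetMean_const_mul, mul_left_comm]
      refine mul_le_mul_of_nonneg_left ?_ (by split_ifs <;> simp)
      refine (ih hWA.2 (fun u => c u * if s(w, u) ∈ T then 0 else 1) fun u hu => ?_).trans_eq ?_
      · have := hc u hu
        split_ifs <;> simp [this]
      · congr 1
        exact Finset.prod_congr rfl fun u hu => by ring
    -- It remains to average over row w, by the one-row bound with weights c u * π ^ W.card.
    refine (subsetMean_mono h0.le h1 hstep).trans ?_
    rw [subsetMean_const_mul, pow_succ, mul_assoc]
    refine mul_le_mul_of_nonneg_left ?_ (pow_nonneg (by linarith) _)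
    refine (subsetMean_star_le h0 h1 w hA (fun u => c u * π ^ W.card) fun u hu => ?_).trans_eq ?_
    · have := hc u hu
      exact ⟨mul_nonneg this.1 (pow_nonneg hπ0 _),
        mul_le_one₀ this.2 (pow_nonneg hπ0 _) (pow_le_one₀ hπ0 hπ1)⟩
    · congr 1
      exact Finset.prod_congr rfl fun u hu => by rw [pow_succ, hπ]; ring

end Graph

/-- Allows probabilities and expectations over finitely many graphs to be computed as sums over
single graphs. -/
instance {V : Type*} [Countable V] : MeasurableSingletonClass (SimpleGraph V) where
  measurableSet_singleton G := by
    rw [← SimpleGraph.measurableEmbedding_edgeSet.measurableSet_image, Set.image_singleton]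
    exact measurableSet_singleton _

lemma boole_and_mul (P Q : Prop) [Decidable P] [Decidable Q] :
    (if P ∧ Q then (1 : ℝ) else 0) = (if P then 1 else 0) * if Q then 1 else 0 := by
  split_ifs <;> simp_all

lemma boole_congr {P Q : Prop} {_ : Decidable P} {_ : Decidable Q} (h : P ↔ Q) :
    (if P then (1 : ℝ) else 0) = if Q then 1 else 0 :=
  if_congr h rfl rfl

/-! ### Domination probabilities in the binomial random graph. -/

section Model

variable {V : Type*} [Fintype V] [DecidableEq V]

-- The bridge from the measure to finite sums: a graph corresponds to its edge set, a set of
-- non-diagonal pairs.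
open Classical in
lemma binomialRandom_real_eq_subsetMean (p : unitInterval) (S : Set (SimpleGraph V)) :
    (SimpleGraph.binomialRandom V p).real S =
      subsetMean (p : ℝ) (Finset.univ.filter fun e : Sym2 V => ¬ e.IsDiag)
        (fun T => if SimpleGraph.fromEdgeSet (T : Set (Sym2 V)) ∈ S then 1 else 0) := by
  set N := Finset.univ.filter fun e : Sym2 V => ¬ e.IsDiag with hN
  have hNc : N.card = (Nat.card V).choose 2 := by
    rw [Nat.card_eq_fintype_card, ← Sym2.card_diagSet_compl, ← Set.toFinset_card]
    congr 1
    ext e; simp [hN]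
  have hsub : ∀ G : SimpleGraph V, G.edgeFinset ⊆ N := fun G e he => by
    simp only [hN, Finset.mem_filter, Finset.mem_univ, true_and]
    exact G.not_isDiag_of_mem_edgeSet (SimpleGraph.mem_edgeFinset.1 he)
  have h1 : (SimpleGraph.binomialRandom V p).real S =
      ∑ G ∈ Finset.univ.filter (· ∈ S), (SimpleGraph.binomialRandom V p).real {G} := by
    rw [sum_measureReal_singleton]
    congr 1
    ext; simp
  rw [h1, Finset.sum_filter, subsetMean]
  refine Finset.sum_bij' (fun G _ => G.edgeFinset)
    (fun T _ => SimpleGraph.fromEdgeSet (T : Set (Sym2 V))) (fun G _ => Finset.mem_powerset.2 (hsub G))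
    (by simp) (by simp) ?_ ?_
  · intro T hT
    ext e
    have : e ∈ T → ¬ e.IsDiag := fun h => (Finset.mem_filter.1 (Finset.mem_powerset.1 hT h)).2
    simp
    tauto
  · intro G _
    have h2 : (SimpleGraph.binomialRandom V p).real {G} =
        (p : ℝ) ^ G.edgeFinset.card * (1 - p : ℝ) ^ (N \ G.edgeFinset).card := by
      rw [measureReal_def, SimpleGraph.binomialRandom_singleton, Finset.card_sdiff_of_subset (hsub G),
        hNc, ← SimpleGraph.coe_edgeFinset, Set.ncard_coe_finset]
      simp
    rw [h2]
    simp

lemma star_subset_offDiag {v : V} {A : Finset V} (hv : v ∉ A) :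
    star v A ⊆ Finset.univ.filter fun e : Sym2 V => ¬ e.IsDiag := by
  intro e he
  obtain ⟨u, hu, rfl⟩ := mem_star.1 he
  simp
  rintro rfl
  exact hv hu

lemma cross_subset_offDiag {W A : Finset V} (h : Disjoint W A) :
    cross W A ⊆ Finset.univ.filter fun e : Sym2 V => ¬ e.IsDiag :=
  Finset.biUnion_subset.2 fun _ hv => star_subset_offDiag (Finset.disjoint_left.1 h hv)

/-- The probability that a given vertex set is dominating. -/
lemma binomialRandom_real_isDominatingSet (p : unitInterval) (K : Finset V) :
    (SimpleGraph.binomialRandom V p).real {G | IsDominatingSet G K} =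
      (1 - (1 - (p : ℝ)) ^ K.card) ^ (Fintype.card V - K.card) := by
  classical
  rw [binomialRandom_real_eq_subsetMean]
  have hd : Disjoint Kᶜ K := disjoint_compl_left
  have h1 := subsetMean_prod (p := (p : ℝ)) Kᶜ (fun v => star v K) (pairwiseDisjoint_star hd)
    (fun _ T => 1 - if T = ∅ then 1 else 0)
  simp only [subsetMean_sub, subsetMean_const, subsetMean_ite_eq_empty, card_star,
    Finset.prod_const, Finset.card_compl] at h1
  rw [← h1, ← cross, ← subsetMean_inter_of_subset (cross_subset_offDiag hd)]
  refine subsetMean_congr fun T hT => ?_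
  have h2 : ∀ v ∈ Kᶜ, T ∩ cross Kᶜ K ∩ star v K = ∅ ↔ ∀ u ∈ K, s(v, u) ∉ T := by
    intro v hv
    rw [inter_star_eq_empty]
    have := fun u => mk_mem_cross (u := u) (A := K) hv
    grind
  have h3 : ∀ v ∈ Kᶜ, (1 - if T ∩ cross Kᶜ K ∩ star v K = ∅ then 1 else 0 : ℝ) =
      if ∃ u ∈ K, s(v, u) ∈ T then 1 else 0 := by
    intro v hv
    rw [← sub_eq_zero]
    simp only [h2 v hv]
    by_cases h : ∃ u ∈ K, s(v, u) ∈ T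
    · rw [if_pos h, if_neg (by simpa using h)]; simp
    · rw [if_neg h, if_pos (by simpa using h)]; simp
  rw [Finset.prod_congr rfl h3, Finset.prod_ite_zero, Finset.prod_const_one]
  congr 1
  simp only [Set.mem_ofPred_eq, IsDominatingSet, Dominates, SimpleGraph.fromEdgeSet_adj,
    Finset.mem_univ, true_imp_iff, Finset.mem_compl, Finset.mem_coe, Sym2.eq_swap, eq_iff_iff]
  refine forall₂_congr fun v hv => exists_congr fun u => and_congr_right fun hu => ?_
  rw [Sym2.eq_swap]
  have : u ≠ v := by rintro rfl; exact hv hu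
  simp [this]

/-- The probability that two given vertex sets dominate each other. -/
lemma binomialRandom_real_dominateEachOther_le (p : unitInterval) (h0 : 0 < (p : ℝ))
    {A B : Finset V} (hA : A.Nonempty) {k : ℕ} (hAB : (A \ B).card = k) (hBA : (B \ A).card = k) :
    (SimpleGraph.binomialRandom V p).real {G | DominateEachOther G A B} ≤
      (1 - (1 - (p : ℝ)) ^ A.card) ^ k * (1 - (1 - (p : ℝ)) ^ (A ∩ B).card *
        (((1 - p) - (1 - (p : ℝ)) ^ A.card) / (1 - (1 - (p : ℝ)) ^ A.card)) ^ k) ^ k := by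
  classical
  rw [binomialRandom_real_eq_subsetMean]
  set t := (1 - (p : ℝ)) ^ A.card with ht
  set π := (1 - p - t) / (1 - t) with hπ
  set U := A \ B
  set W := B \ A
  set C := A ∩ B
  have hWA : Disjoint W A := Finset.sdiff_disjoint
  have hUC : Disjoint U C := by
    rw [Finset.disjoint_left]; grind
  -- Pairs between U and W lie in `cross W A`, so these two disjoint blocks contain every pair that
  -- matters; pairs inside U or inside W are irrelevant.
  have hd : Disjoint (cross U C) (cross W A) := by
    rw [Finset.disjoint_left]
    intro e h1 h2
    obtain ⟨v, hv, u, hu, rfl⟩ := mem_cross.1 h1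
    obtain ⟨v', hv', u', hu', h⟩ := mem_cross.1 h2
    rw [Sym2.eq_iff] at h
    grind
  have hsub := Finset.union_subset (cross_subset_offDiag hUC) (cross_subset_offDiag hWA)
  -- The weight for `subsetMean_cross_le`: 1 if u ∈ U has no neighbour in C and so needs one in W.
  -- Weight 0 on the rest of A makes those factors trivial.
  set φ : Finset (Sym2 V) → V → ℝ := fun T u =>
    if u ∈ U then (if T ∩ star u C = ∅ then 1 else 0) else 0 with hφ
  set f : Finset (Sym2 V) → ℝ := fun T =>
    (∏ w ∈ W, if T ∩ star w A = ∅ then 0 else 1) *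
      ∏ u ∈ A, (1 - φ T u * if ∀ w ∈ W, s(w, u) ∉ T then 1 else 0) with hf
  have e1 : ∀ T ⊆ Finset.univ.filter (fun e : Sym2 V => ¬ e.IsDiag),
      (if SimpleGraph.fromEdgeSet (T : Set (Sym2 V)) ∈ {G | DominateEachOther G A B} then (1 : ℝ)
        else 0) = f (T ∩ (cross U C ∪ cross W A)) := by
    intro T hT
    set T' := T ∩ (cross U C ∪ cross W A) with hT'
    have b1 : ∀ v ∈ W, ∀ u ∈ A, (s(v, u) ∈ T' ↔ s(v, u) ∈ T) := fun v hv u hu => by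
      have := mk_mem_cross hv hu
      grind
    have b2 : ∀ v ∈ U, ∀ u ∈ C, (s(v, u) ∈ T' ↔ s(v, u) ∈ T) := fun v hv u hu => by
      have := mk_mem_cross hv hu
      grind
    have c1 : ∀ w ∈ W, (if T' ∩ star w A = ∅ then (0 : ℝ) else 1) =
        if ∃ u ∈ A, s(w, u) ∈ T then 1 else 0 := by
      intro w hw
      have := b1 w hw
      rw [← ite_not]
      refine if_congr ?_ rfl rfl
      rw [inter_star_eq_empty]
      grind
    have c2 : ∀ u ∈ A, (1 - φ T' u * if ∀ w ∈ W, s(w, u) ∉ T' then 1 else 0) =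
        if u ∈ U → ∃ b ∈ B, s(b, u) ∈ T then 1 else 0 := by
      intro u hu
      by_cases hU : u ∈ U
      · have h1 : (T' ∩ star u C = ∅ ∧ ∀ w ∈ W, s(w, u) ∉ T') ↔ ∀ b ∈ B, s(b, u) ∉ T := by
          rw [inter_star_eq_empty]
          have b2 := b2 u hU
          have b1 := fun v hv => b1 v hv u hu
          constructor
          · rintro ⟨h2, h3⟩ b hb hbT
            by_cases hbA : b ∈ A
            · have hbC : b ∈ C := Finset.mem_inter.2 ⟨hbA, hb⟩
              rw [Sym2.eq_swap] at hbT
              exact h2 b hbC ((b2 b hbC).2 hbT)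
            · have hbW : b ∈ W := Finset.mem_sdiff.2 ⟨hb, hbA⟩
              exact h3 b hbW ((b1 b hbW).2 hbT)
          · intro h
            refine ⟨fun c hc hcT => h c (Finset.mem_inter.1 hc).2 ?_, fun w hw hwT =>
              h w (Finset.mem_sdiff.1 hw).1 ((b1 w hw).1 hwT)⟩
            rw [Sym2.eq_swap]
            exact (b2 c hc).1 hcT
        rw [hφ]
        simp only [hU, if_true, true_imp_iff]
        rw [← boole_and_mul, if_congr h1 rfl rfl]
        by_cases h : ∃ b ∈ B, s(b, u) ∈ T
        · rw [if_pos h, if_neg (by simpa using h)]; simp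
        · rw [if_neg h, if_pos (by simpa using h)]; simp
      · simp [hφ, hU]
    rw [hf]
    simp only
    rw [Finset.prod_congr rfl c1, Finset.prod_congr rfl c2, Finset.prod_ite_zero,
      Finset.prod_ite_zero, Finset.prod_const_one, Finset.prod_const_one, ← boole_and_mul]
    refine boole_congr ?_
    simp only [Set.mem_ofPred_eq, DominateEachOther, Dominates, SimpleGraph.fromEdgeSet_adj,
      Finset.mem_coe]
    refine and_congr ?_ ?_
    · constructor
      · intro h w hw
        obtain ⟨u, hu, h1⟩ := h w (Finset.mem_sdiff.1 hw).1 (Finset.mem_sdiff.1 hw).2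
        exact ⟨u, hu, by rw [Sym2.eq_swap]; exact h1.1⟩
      · intro h w hw hwA
        obtain ⟨u, hu, h1⟩ := h w (Finset.mem_sdiff.2 ⟨hw, hwA⟩)
        exact ⟨u, hu, by rw [Sym2.eq_swap]; exact h1, by rintro rfl; exact hwA hu⟩
    · constructor
      · intro h u hu hU
        obtain ⟨b, hb, h1⟩ := h u hu (Finset.mem_sdiff.1 hU).2
        exact ⟨b, hb, h1.1⟩
      · intro h u hu huB
        obtain ⟨b, hb, h1⟩ := h u hu (Finset.mem_sdiff.2 ⟨hu, huB⟩)
        exact ⟨b, hb, h1, by rintro rfl; exact huB hb⟩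
  rw [subsetMean_congr e1, subsetMean_inter_of_subset hsub, subsetMean_union hd]
  -- With the edges from U to C fixed, the weights are constants and negative correlation applies to
  -- the edges from W to A.
  have e2 : ∀ T ⊆ cross U C, subsetMean (p : ℝ) (cross W A) (fun T' => f (T ∪ T')) ≤
      (1 - t) ^ k * ∏ u ∈ U, (1 - π ^ k * if T ∩ star u C = ∅ then 1 else 0) := by
    intro T hT
    have h2 : ∀ T' ⊆ cross W A, f (T ∪ T') =
        (∏ w ∈ W, if T' ∩ star w A = ∅ then 0 else 1) *
          ∏ u ∈ A, (1 - φ T u * if ∀ w ∈ W, s(w, u) ∉ T' then 1 else 0) := by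
      intro T' hT'
      have a1 : ∀ w ∈ W, ∀ u ∈ A, (s(w, u) ∈ T ∪ T' ↔ s(w, u) ∈ T') := by
        intro w hw u hu
        have := Finset.disjoint_right.1 hd (mk_mem_cross hw hu)
        grind
      have a2 : ∀ u ∈ U, ∀ c ∈ C, (s(u, c) ∈ T ∪ T' ↔ s(u, c) ∈ T) := by
        intro w hw u hu
        have := Finset.disjoint_left.1 hd (mk_mem_cross hw hu)
        grind
      rw [hf]
      simp only
      congr 1
      · refine Finset.prod_congr rfl fun w hw => if_congr ?_ rfl rfl
        have := a1 w hw
        rw [inter_star_eq_empty, inter_star_eq_empty]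
        grind
      · refine Finset.prod_congr rfl fun u hu => ?_
        have h3 : φ (T ∪ T') u = φ T u := by
          rw [hφ]
          simp only
          by_cases hU : u ∈ U
          · rw [if_pos hU, if_pos hU]
            refine if_congr ?_ rfl rfl
            have := a2 u hU
            rw [inter_star_eq_empty, inter_star_eq_empty]
            grind
          · rw [if_neg hU, if_neg hU]
        rw [h3, if_congr (forall₂_congr fun w hw => not_congr (a1 w hw u hu)) rfl rfl]
    rw [subsetMean_congr h2]
    have h3 := subsetMean_cross_le h0 p.2.2 hA hWA (φ T) fun u _ => ?_
    · refine (le_of_eq (subsetMean_congr fun T' _ => by congr!)).trans (h3.trans_eq ?_)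
      rw [hBA]
      congr 1
      rw [← Finset.prod_subset (Finset.sdiff_subset : U ⊆ A) fun u _ hu => by
        have hu : u ∉ U := hu
        simp [hφ, hu]]
      exact Finset.prod_congr rfl fun u hu => by simp only [hφ, if_pos hu]; ring
    · rw [hφ]
      simp only
      split_ifs <;> simp
  refine (subsetMean_mono h0.le p.2.2 e2).trans_eq ?_
  have h1 := subsetMean_prod (p := (p : ℝ)) U (fun v => star v C) (pairwiseDisjoint_star hUC)
    (fun _ T => 1 - π ^ k * if T = ∅ then 1 else 0)
  rw [← cross] at h1
  rw [subsetMean_const_mul, h1]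
  simp only [subsetMean_sub, subsetMean_const, subsetMean_const_mul, subsetMean_ite_eq_empty,
    card_star, Finset.prod_const, hAB]
  rw [mul_comm (π ^ k)]

end Model

/-! ### The first moment and the comparison with 1 - 2 q^r. -/

lemma expectedNumDominatingSets_eq (n : ℕ) (p : unitInterval) (r : ℕ) :
    expectedNumDominatingSets n p r =
      n.choose r * (1 - (1 - (p : ℝ)) ^ r) ^ (n - r) := by
  classical
  have h1 : ∀ G : SimpleGraph (Fin n), (numDominatingSets G r : ℝ) =
      ∑ K ∈ Finset.univ.powersetCard r, {G | IsDominatingSet G K}.indicator 1 G := by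
    intro G
    simp [numDominatingSets, Set.indicator_apply]
  simp only [expectedNumDominatingSets, h1]
  rw [integral_finsetSum _ fun K _ => Integrable.of_finite]
  have h2 : ∀ K ∈ (Finset.univ : Finset (Fin n)).powersetCard r,
      ∫ G, {G | IsDominatingSet G K}.indicator 1 G ∂(SimpleGraph.binomialRandom (Fin n) p) =
        (1 - (1 - (p : ℝ)) ^ r) ^ (n - r) := by
    intro K hK
    rw [integral_indicator_one (Set.toFinite _).measurableSet, binomialRandom_real_isDominatingSet,
      (Finset.mem_powersetCard.1 hK).2, Fintype.card_fin]
  rw [Finset.sum_congr rfl h2]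
  simp

lemma one_sub_pow_le_exp {p : ℝ} (h1 : p ≤ 1) (m : ℕ) : (1 - p) ^ m ≤ Real.exp (-(p * m)) := by
  calc (1 - p) ^ m ≤ Real.exp (-p) ^ m :=
        pow_le_pow_left₀ (by linarith) (by linarith [Real.add_one_le_exp (-p)]) _
    _ = _ := by rw [← Real.exp_nat_mul]; ring_nf

/-- Passing from the exact mutual domination bound to powers of `1 - 2 q ^ r`, where
`y = q ^ (r - 1)`. -/
lemma mutual_bound_le {p : ℝ} (h0 : 0 < p) (h1 : p ≤ 1) {R k s : ℕ} (hk : k + s = R + 1)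
    (hy : (1 - p) ^ R ≤ 1 / 4) :
    (1 - (1 - p) ^ (R + 1)) ^ k * (1 - (1 - p) ^ s *
        (((1 - p) - (1 - p) ^ (R + 1)) / (1 - (1 - p) ^ (R + 1))) ^ k) ^ k ≤
      Real.exp (2 * (R + 1) * ((1 - p) ^ R) ^ 2 + 4 * (R + 1) ^ 2 * p * ((1 - p) ^ R) ^ 2) *
        (1 - 2 * (1 - p) ^ (R + 1)) ^ k := by
  set q := 1 - p with hq
  have hq0 : 0 ≤ q := by linarith
  set y := q ^ R with hy'
  set x := q ^ (R + 1) with hx'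
  have hxy : x = q * y := by rw [hx', pow_succ]; ring
  have hy0 : 0 ≤ y := pow_nonneg hq0 _
  have hx0 : 0 ≤ x := pow_nonneg hq0 _
  have hxley : x ≤ y := by rw [hxy]; nlinarith
  have hx1 : 0 < 1 - x := by linarith
  have hkR : (k : ℝ) ≤ R + 1 := by exact_mod_cast (by omega : k ≤ R + 1)
  have hk0 : (0 : ℝ) ≤ k := k.cast_nonneg
  -- Uses 1 - x - p y = 1 - y. The relative error of π against q is thus p y / (1 - x), and
  -- Bernoulli's inequality controls its k-th power.
  have e1 : (q - x) / (1 - x) = q * (1 + -(p * y / (1 - x))) := by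
    rw [hxy] at hx1 ⊢
    field_simp
    rw [hq]; ring
  have hpy : p * y / (1 - x) ≤ 1 := by
    rw [div_le_one hx1]; nlinarith
  have hb : 1 + (k : ℝ) * -(p * y / (1 - x)) ≤ (1 + -(p * y / (1 - x))) ^ k :=
    one_add_mul_le_pow (by linarith) k
  have hpy2 : p * y / (1 - x) ≤ 2 * (p * y) := by
    rw [div_le_iff₀ hx1]; nlinarith [mul_nonneg h0.le hy0]
  have e2 : q ^ s * q ^ k = x := by rw [← pow_add, hx', ← hk, add_comm]
  have hlow : x * (1 - k * (2 * (p * y))) ≤ q ^ s * ((q - x) / (1 - x)) ^ k := by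
    rw [e1, mul_pow, ← mul_assoc (q ^ s), e2]
    refine mul_le_mul_of_nonneg_left (le_trans ?_ hb) hx0
    nlinarith
  have hup : q ^ s * ((q - x) / (1 - x)) ^ k ≤ 1 := by
    rw [e1, mul_pow, ← mul_assoc, e2]
    have h5 : (1 + -(p * y / (1 - x))) ^ k ≤ 1 := by
      refine pow_le_one₀ (by linarith) ?_
      have : 0 ≤ p * y / (1 - x) := by positivity
      linarith
    nlinarith
  rw [← mul_pow]
  set η := 2 * x ^ 2 + 4 * k * p * x * y with hη
  have hη0 : 0 ≤ η := by positivity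
  have hbase : (1 - x) * (1 - q ^ s * ((q - x) / (1 - x)) ^ k) ≤ (1 - 2 * x) * Real.exp η := by
    have a0 : 0 ≤ k * p * x * y := by positivity
    have a1 : (1 - x) * (1 - q ^ s * ((q - x) / (1 - x)) ^ k) ≤
        (1 - x) * (1 - x * (1 - k * (2 * (p * y)))) :=
      mul_le_mul_of_nonneg_left (by linarith) hx1.le
    -- The excess over 1 - 2x is at most x^2 + 2kpxy = η / 2, and 1 - 2x ≥ 1/2.
    have a2 : (1 - x) * (1 - x * (1 - k * (2 * (p * y)))) ≤ (1 - 2 * x) * (η + 1) := by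
      rw [hη]
      nlinarith [mul_nonneg hx0 a0, mul_nonneg (sq_nonneg x) (by linarith : 0 ≤ 1 / 4 - x),
        mul_nonneg a0 (by linarith : 0 ≤ 1 / 4 - x)]
    exact a1.trans (a2.trans (mul_le_mul_of_nonneg_left (Real.add_one_le_exp η) (by linarith)))
  refine (pow_le_pow_left₀ (mul_nonneg hx1.le (by linarith)) hbase k).trans ?_
  rw [mul_pow, mul_comm, ← Real.exp_nat_mul]
  refine mul_le_mul_of_nonneg_right (Real.exp_le_exp.2 ?_) (pow_nonneg (by linarith) _)
  have b1 : x ^ 2 ≤ y ^ 2 := pow_le_pow_left₀ hx0 hxley 2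
  have b2 : x * y ≤ y ^ 2 := by rw [sq]; exact mul_le_mul_of_nonneg_right hxley hy0
  have b3 : (k : ℝ) ^ 2 ≤ (R + 1) ^ 2 := pow_le_pow_left₀ hk0 hkR 2
  calc k * η = 2 * (k * x ^ 2) + 4 * p * (k ^ 2 * (x * y)) := by rw [hη]; ring
    _ ≤ 2 * ((R + 1) * y ^ 2) + 4 * p * ((R + 1) ^ 2 * y ^ 2) := by gcongr
    _ = _ := by ring

/-! ### Size of the expectation threshold and of the error term. -/

section Threshold

variable {n : ℕ} {p : unitInterval}

/-- At R = ⌈2 log n / p⌉ one has q^R ≤ n^(-2), so a fixed R-set dominates with probability at least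
1/2 ≥ 1/(np). -/
lemma rHat_le (hL : 6 ≤ Real.log n) (hnp : Real.log n ^ 3 ≤ n * (p : ℝ)) :
    (rHat n p : ℝ) ≤ 2 * Real.log n / p + 1 ∧
      1 / ((n : ℝ) * (p : ℝ)) ≤ expectedNumDominatingSets n p (rHat n p) := by
  set L := Real.log n with hLdef
  have hn : 0 < n := by
    rcases Nat.eq_zero_or_pos n with h | h
    · simp [hLdef, h] at hL; linarith
    · exact h
  have hn' : (0 : ℝ) < n := by exact_mod_cast hn
  have hnL : L ≤ n := by linarith [Real.log_le_sub_one_of_pos hn']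
  have hL3 : 36 * L ≤ L ^ 3 := by nlinarith [mul_nonneg (by linarith : 0 ≤ L - 6) (by linarith : 0 ≤ L)]
  have hnp0 : 0 < (n : ℝ) * p := by nlinarith
  have hp0 : 0 < (p : ℝ) := pos_of_mul_pos_right hnp0 hn'.le
  have hp1 : (p : ℝ) ≤ 1 := p.2.2
  set R := ⌈2 * L / p⌉₊ with hR
  have hR1 : 2 * L / p ≤ R := Nat.le_ceil _
  have hR2 : (R : ℝ) < 2 * L / p + 1 := Nat.ceil_lt_add_one (by positivity)
  have hRn : R ≤ n := by
    have : 2 * L / p + 1 ≤ n := by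
      have h2 : 2 * L / p ≤ n - 1 := by
        rw [div_le_iff₀ hp0]; nlinarith
      linarith
    exact_mod_cast (hR2.trans_le this).le
  have hmem : 1 / ((n : ℝ) * (p : ℝ)) ≤ expectedNumDominatingSets n p R := by
    rw [expectedNumDominatingSets_eq]
    have hq : (1 - (p : ℝ)) ^ R ≤ 1 / n ^ 2 := by
      refine (one_sub_pow_le_exp hp1 R).trans ?_
      have h3 : 2 * L ≤ p * R := by
        rw [div_le_iff₀ hp0] at hR1; linarith
      calc Real.exp (-(p * R)) ≤ Real.exp (-(2 * L)) := Real.exp_le_exp.2 (by linarith)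
        _ = 1 / n ^ 2 := by
          rw [Real.exp_neg, two_mul, Real.exp_add, hLdef, Real.exp_log hn']; field_simp
    have hq0 : 0 ≤ (1 - (p : ℝ)) ^ R := pow_nonneg (by linarith) _
    have hn2 : 1 / (n : ℝ) ^ 2 ≤ 1 := by
      rw [div_le_one (by positivity)]; nlinarith
    have h4 : 1 + ((n - R : ℕ) : ℝ) * -((1 - (p : ℝ)) ^ R) ≤ (1 + -(1 - (p : ℝ)) ^ R) ^ (n - R) :=
      one_add_mul_le_pow (by linarith) _
    have h5 : ((n - R : ℕ) : ℝ) ≤ n := by exact_mod_cast Nat.sub_le _ _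
    have h6 : ((n - R : ℕ) : ℝ) * (1 - (p : ℝ)) ^ R ≤ 1 / 2 := by
      calc _ ≤ (n : ℝ) * (1 / n ^ 2) := by gcongr
        _ = 1 / n := by field_simp
        _ ≤ 1 / 2 := by gcongr; linarith
    have h7 : (1 : ℝ) ≤ n.choose R := by exact_mod_cast Nat.choose_pos hRn
    have h8 : 1 / ((n : ℝ) * p) ≤ 1 / 2 := by gcongr; nlinarith
    have h9 : (1 / 2 : ℝ) ≤ (1 - (1 - (p : ℝ)) ^ R) ^ (n - R) := by
      rw [sub_eq_add_neg 1 ((1 - (p : ℝ)) ^ R)]; linarith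
    nlinarith
  -- Non-emptiness ensures that the infimum is attained, instead of being the default 0.
  have hmem' : R ∈ {r : ℕ | 1 / ((n : ℝ) * (p : ℝ)) ≤ expectedNumDominatingSets n p r} := hmem
  have hle : rHat n p ≤ R := Nat.sInf_le hmem'
  exact ⟨le_trans (by exact_mod_cast hle) hR2.le, Nat.sInf_mem ⟨R, hmem'⟩⟩

/-- With y = q^R, the expectation is at most n^R exp(-y (n - R)). As it is at least 1/(np), taking
logarithms gives y (n - R) ≤ (R + 1) log n, while R ≤ n/2. -/
lemma one_sub_pow_rHat_le (hL : 6 ≤ Real.log n) (hnp : Real.log n ^ 3 ≤ n * (p : ℝ)) :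
    (rHat n p + 1 : ℝ) ≤ 3 * Real.log n / p ∧
      (1 - (p : ℝ)) ^ rHat n p ≤ 6 * Real.log n ^ 2 / (n * p) := by
  obtain ⟨h1, h2⟩ := rHat_le hL hnp
  set L := Real.log n with hLdef
  set R := rHat n p with hR
  have hn : 0 < n := by
    rcases Nat.eq_zero_or_pos n with h | h
    · simp [hLdef, h] at hL; linarith
    · exact h
  have hn' : (0 : ℝ) < n := by exact_mod_cast hn
  have hL3 : 36 * L ≤ L ^ 3 := by nlinarith [mul_nonneg (by linarith : 0 ≤ L - 6) (by linarith : 0 ≤ L)]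
  have hnp0 : 0 < (n : ℝ) * p := by nlinarith
  have hp0 : 0 < (p : ℝ) := pos_of_mul_pos_right hnp0 hn'.le
  have hp1 : (p : ℝ) ≤ 1 := p.2.2
  have h3 : (R + 1 : ℝ) ≤ 3 * L / p := by
    have : 2 ≤ L / p := by rw [le_div_iff₀ hp0]; nlinarith
    have e : 3 * L / p = 2 * L / p + L / p := by ring
    linarith
  refine ⟨h3, ?_⟩
  have h4 : (3 * L / p : ℝ) ≤ n / 2 := by
    rw [div_le_iff₀ hp0]; nlinarith
  have hRn : R ≤ n := by
    have : (R : ℝ) ≤ n := by linarith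
    exact_mod_cast this
  set y := (1 - (p : ℝ)) ^ R with hy
  have hy0 : 0 ≤ y := pow_nonneg (by linarith) _
  have hy1 : y ≤ 1 := pow_le_one₀ (by linarith) (by linarith)
  rw [expectedNumDominatingSets_eq] at h2
  have h5 : ((n.choose R : ℕ) : ℝ) ≤ (n : ℝ) ^ R := by exact_mod_cast Nat.choose_le_pow n R
  have h6 : (1 - y) ^ (n - R) ≤ Real.exp (-(y * (n - R : ℕ))) := one_sub_pow_le_exp hy1 _
  have h7 : 1 / ((n : ℝ) * p) ≤ (n : ℝ) ^ R * Real.exp (-(y * (n - R : ℕ))) :=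
    h2.trans (mul_le_mul h5 h6 (pow_nonneg (by linarith) _) (by positivity))
  have h8 := Real.log_le_log (by positivity) h7
  rw [Real.log_mul (by positivity) (Real.exp_pos _).ne', Real.log_exp, Real.log_pow, one_div,
    Real.log_inv, Real.log_mul hn'.ne' hp0.ne', Nat.cast_sub hRn, ← hLdef] at h8
  have h9 : Real.log p ≤ 0 := Real.log_nonpos hp0.le hp1
  have h10 : y * (n / 2) ≤ y * (n - R) := mul_le_mul_of_nonneg_left (by linarith) hy0
  have h11 : (R + 1) * L ≤ 3 * L / p * L := mul_le_mul_of_nonneg_right h3 (by linarith)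
  rw [le_div_iff₀ hnp0]
  have h12 : y * (n / 2) * p ≤ 3 * L / p * L * p := mul_le_mul_of_nonneg_right (by linarith) hp0.le
  have h13 : 3 * L / p * L * p = 3 * L ^ 2 := by field_simp
  nlinarith

lemma correction_le (hL : 24 ≤ Real.log n) (hnp : Real.log n ^ 3 ≤ n * (p : ℝ))
    (hnp3 : Real.log n ^ 9 ≤ (n : ℝ) ^ 2 * (p : ℝ) ^ 3) :
    (1 - (p : ℝ)) ^ rHat n p ≤ 1 / 4 ∧
      2 * (rHat n p + 1) * ((1 - (p : ℝ)) ^ rHat n p) ^ 2 +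
        4 * (rHat n p + 1) ^ 2 * p * ((1 - (p : ℝ)) ^ rHat n p) ^ 2 ≤ 1600 / Real.log n ^ 3 := by
  obtain ⟨h1, h2⟩ := one_sub_pow_rHat_le (by linarith) hnp
  set L := Real.log n with hLdef
  set R := rHat n p
  set y := (1 - (p : ℝ)) ^ R with hy
  have hL0 : 0 < L := by linarith
  have hnp0 : 0 < (n : ℝ) * p := lt_of_lt_of_le (by positivity) hnp
  have hp0 : 0 < (p : ℝ) := pos_of_mul_pos_right hnp0 n.cast_nonneg
  have hn0 : 0 < (n : ℝ) := pos_of_mul_pos_left hnp0 hp0.le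
  have hy0 : 0 ≤ y := pow_nonneg (by linarith [p.2.2]) _
  constructor
  · refine h2.trans ?_
    rw [div_le_iff₀ hnp0]
    -- The threshold 24 comes from 6 L^2 / (np) ≤ 6 / L ≤ 1/4.
    nlinarith [mul_nonneg (sq_nonneg L) (by linarith : 0 ≤ L - 24)]
  · have hy2 : y ^ 2 ≤ (6 * L ^ 2 / (n * p)) ^ 2 := pow_le_pow_left₀ hy0 h2 2
    have hD : 0 < (n : ℝ) ^ 2 * (p : ℝ) ^ 3 := by positivity
    calc _ ≤ 2 * (3 * L / p) * (6 * L ^ 2 / (n * p)) ^ 2 +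
          4 * (3 * L / p) ^ 2 * p * (6 * L ^ 2 / (n * p)) ^ 2 := by gcongr
      _ = (216 * L ^ 5 + 1296 * L ^ 6) / (n ^ 2 * p ^ 3) := by field_simp; ring
      _ ≤ (1600 * L ^ 6) / (L ^ 9) := by
        gcongr
        nlinarith [mul_nonneg (pow_nonneg hL0.le 5) (by linarith : 0 ≤ L - 24), pow_nonneg hL0.le 5]
      _ = 1600 / L ^ 3 := by field_simp

end Threshold

end RandomDomination

/-! ### Assembly. -/

theorem mainTheorem3 (p : ℕ → unitInterval)
    (hp : ∀ᶠ n : ℕ in atTop, Real.log n ^ 3 * (n : ℝ) ^ (-(2 / 3) : ℝ) ≤ (p n : ℝ)) :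
    ∃ ε : ℕ → ℝ, Tendsto ε atTop (𝓝 0) ∧
      ∀ᶠ n : ℕ in atTop, ∀ r : ℕ, r = RandomDomination.rHat n (p n) + 1 →
        ∀ (s : ℕ) (A B : Finset (Fin n)), A.card = r → B.card = r → (A ∩ B).card = s →
          (SimpleGraph.binomialRandom (Fin n) (p n)).real
              {G : SimpleGraph (Fin n) | RandomDomination.DominateEachOther G A B} ≤
            (1 + ε n) * (1 - 2 * (1 - (p n : ℝ)) ^ r) ^ (r - s) := by
  have hlog : Tendsto (fun n : ℕ => Real.log n) atTop atTop :=
    Real.tendsto_log_atTop.comp tendsto_natCast_atTop_atTop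
  refine ⟨fun n => Real.exp (1600 / Real.log n ^ 3) - 1, ?_, ?_⟩
  · have h1 : Tendsto (fun n : ℕ => 1600 / Real.log n ^ 3) atTop (𝓝 0) :=
      ((tendsto_pow_atTop (by norm_num)).comp hlog).const_div_atTop 1600
    simpa using ((Real.continuous_exp.tendsto 0).comp h1).sub_const 1
  · filter_upwards [hp, hlog.eventually_ge_atTop 24, eventually_ge_atTop 1] with n hpn hL hn
    rintro r rfl s A B hA hB hs
    have hn1 : (1 : ℝ) ≤ n := by exact_mod_cast hn
    have hn0 : (0 : ℝ) < n := by linarith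
    have hL0 : 0 < Real.log n := by linarith
    have hp0 : 0 < (p n : ℝ) := lt_of_lt_of_le (by positivity) hpn
    have hnp : Real.log n ^ 3 ≤ n * (p n : ℝ) := by
      calc Real.log n ^ 3 = Real.log n ^ 3 * 1 := by ring
        _ ≤ Real.log n ^ 3 * (n : ℝ) ^ (1 / 3 : ℝ) := by
          gcongr; exact Real.one_le_rpow hn1 (by norm_num)
        _ = n * (Real.log n ^ 3 * (n : ℝ) ^ (-(2 / 3) : ℝ)) := by
          rw [show (1 / 3 : ℝ) = 1 + -(2 / 3) by norm_num, Real.rpow_add hn0, Real.rpow_one]; ring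
        _ ≤ _ := by gcongr
    -- The cube of the hypothesis on p, which is where the exponent 2/3 enters.
    have hnp3 : Real.log n ^ 9 ≤ (n : ℝ) ^ 2 * (p n : ℝ) ^ 3 := by
      calc Real.log n ^ 9 = n ^ 2 * (Real.log n ^ 3 * (n : ℝ) ^ (-(2 / 3) : ℝ)) ^ 3 := by
            rw [mul_pow, ← Real.rpow_natCast ((n : ℝ) ^ (-(2 / 3) : ℝ)), ← Real.rpow_mul hn0.le,
              show (-(2 / 3) * ((3 : ℕ) : ℝ) : ℝ) = -((2 : ℕ) : ℝ) by norm_num, Real.rpow_neg hn0.le,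
              Real.rpow_natCast]
            field_simp
        _ ≤ _ := by gcongr
    obtain ⟨h1, h2⟩ := RandomDomination.correction_le hL hnp hnp3
    have hsr : s ≤ RandomDomination.rHat n (p n) + 1 := by
      rw [← hs, ← hA]; exact Finset.card_le_card Finset.inter_subset_left
    have hkA : (A \ B).card = RandomDomination.rHat n (p n) + 1 - s := by
      rw [Finset.card_sdiff, Finset.inter_comm, hs, hA]
    have hkB : (B \ A).card = RandomDomination.rHat n (p n) + 1 - s := by
      rw [Finset.card_sdiff, hs, hB]
    have key := RandomDomination.binomialRandom_real_dominateEachOther_le (p n) hp0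
      (Finset.card_pos.1 (by omega)) hkA hkB
    rw [hA, hs] at key
    refine key.trans ((RandomDomination.mutual_bound_le hp0 (p n).2.2 (by omega) h1).trans ?_)
    rw [add_sub_cancel]
    refine mul_le_mul_of_nonneg_right (Real.exp_le_exp.2 h2) (pow_nonneg ?_ _)
    have : (1 - (p n : ℝ)) ^ (RandomDomination.rHat n (p n) + 1) ≤
        (1 - (p n : ℝ)) ^ RandomDomination.rHat n (p n) :=
      pow_le_pow_of_le_one (by linarith [(p n).2.2]) (by linarith) (Nat.le_succ _)
    linarith
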